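/- **Setting.** A system is a triple $\Sigma=(X,U,F)$ with nonempty sets $X,U$ and a map $F$ assigning to each $(x,u)\in X\times U$ a nonempty set $F(x,u)\subseteq X$; for $A\subseteq X$ write $F(A,u)=\bigcup_{x\in A}F(x,u)$. Let $Q\subseteq X$ be nonempty. An *invariant cover* $(\mathcal A,G)$ of $\Sigma$ and $Q$ is a finite set $\mathcal A$ of subsets of $Q$ with $Q\subseteq\bigcup_{A\in\mathcal A}A$, together with a map $G:\mathcal A\to U$ such that $F(A,G(A))\subseteq Q$ for all $A\in\mathcal A$. For an integer $\tau\ge1$, a set $\mathcal S$ of sequences $\alpha=(\alpha(0),\dots,\alpha(\tau-1))$ in $\mathcal A$, and $\alpha\in\mathcal S$, put $$P_t(\alpha)=\{\hat\alpha(t+1)\mid\hat\alpha\in\mathcal S,\ \hat\alpha(s)=\alpha(s)\text{ for }0\le s\le t\}\quad(0\le t<\tau-1),\qquad P_{\tau-1}(\alpha)=\{\hat\alpha(0)\mid\hat\alpha\in\mathcal S\}.$$ The set $\mathcal S$ is *$(\tau,Q)$-spanning* if $Q\subseteq\bigcup_{\hat\alpha\in\mathcal S}\hat\alpha(0)$ and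 $F(\alpha(t),G(\alpha(t)))\subseteq\bigcup_{A'\in P_t(\alpha)}A'$ for all $\alpha\in\mathcal S$ and $0\le t<\tau-1$. Put $$N(\mathcal S)=\max_{\alpha\in\mathcal S}\prod_{t=0}^{\tau-1}\#P_t(\alpha),\qquad r_{\rm inv}(\tau,Q)=\min\{N(\mathcal S)\mid\mathcal S\text{ is }(\tau,Q)\text{-spanning}\},$$ $$h(\mathcal A,G)=\lim_{\tau\to\infty}\tfrac1\tau\log_2 r_{\rm inv}(\tau,Q),\qquad h_{\rm inv}=\inf_{(\mathcal A,G)}h(\mathcal A,G),$$ where the limit exists by subadditivity, the infimum is over all invariant covers of $\Sigma$ and $Q$, and $\inf\emptyset=\infty$. The number $h_{\rm inv}$ is the *invariance feedback entropy* of $\Sigma$ and $Q$. **Theorem (universal lower bound for uncertain linear systems).** Let $n\ge1$, $A\in\mathbb R^{n\times n}$, $B\in\mathbb R^{n\times m}$, let $U\subseteq\mathbb R^m$ be nonempty, and let $W\subseteq Q\subseteq\mathbb R^n$ be nonempty sets with $W$ Lebesgue measurable and $Q$ compact. Let $\Sigma=(\mathbb R^n,U,F)$ with $F(x,u)=Ax+Bu+W$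 for all $x\in\mathbb R^n$, $u\in U$. Then the invariance feedback entropy $h_{\rm inv}$ of $\Sigma$ and $Q$ satisfies $$\log_2\left(|\det A|\,\frac{\mu(Q)}{\bigl(\mu(Q)^{1/n}-\mu(W)^{1/n}\bigr)^n}\right)\le h_{\rm inv},$$ where $\mu$ is Lebesgue measure and the left-hand side is read in $[-\infty,\infty]$ with the conventions $c/0=\infty$ for $c>0$, $0/0=0$, $0\cdot\infty=0$, $\log_20=-\infty$ and $\log_2\infty=\infty$ (so the bound is trivial if $\det A=0$ or $\mu(Q)=0$, and it says $h_{\rm inv}=\infty$ if $\det A\ne0$ and $\mu(W)=\mu(Q)>0$). -/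

import Mathlib

open Set Filter Topology MeasureTheory
open scoped ENNReal Matrix

noncomputable section

namespace FeedbackEntropy

/-- The binary logarithm of an extended nonnegative real, with `log₂ 0 = -∞` and `log₂ ∞ = ∞`. -/
def log2 (x : ℝ≥0∞) : EReal :=
  ENNReal.log x / ((Real.log 2 : ℝ) : EReal)

/-- A system `(X, U, F)`: nonempty state and input alphabets and a strict set-valued
transition function `F`, describing `ξ (t + 1) ∈ F (ξ t) (ν t)`. -/
structure ControlSystem (X U : Type*) where
  nonempty_state : Nonempty X
  nonempty_input : Nonempty U
  F : X → U → Set X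
  strict : ∀ x u, (F x u).Nonempty

/-- An invariant cover `(𝒜, G)` of a system and a set `Q`: a finite set `𝒜` of subsets of `Q`
that covers `Q`, with a map `G : 𝒜 → U` such that `F (A, G A) ⊆ Q` for every `A ∈ 𝒜`. -/
structure InvariantCover {X U : Type*} (sys : ControlSystem X U) (Q : Set X) where
  cover : Set (Set X)
  finite : cover.Finite
  subset : ∀ A ∈ cover, A ⊆ Q
  covers : Q ⊆ ⋃₀ cover
  G : cover → U
  invariant : ∀ A : cover, (⋃ x ∈ (A : Set X), sys.F x (G A)) ⊆ Q

namespace InvariantCover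

variable {X U : Type*} {sys : ControlSystem X U} {Q : Set X}

/-- The initial cover elements `{α 0 | α ∈ S}` of a set `S` of sequences of length `τ`. -/
def initial (C : InvariantCover sys Q) {τ : ℕ} (S : Set (Fin τ → C.cover)) : Set C.cover :=
  {A | ∃ β ∈ S, ∃ h : 0 < τ, β ⟨0, h⟩ = A}

/-- The set `P (α|[0;t])`. For `t < τ - 1` it consists of the cover elements `β (t + 1)`, where
`β ∈ S` agrees with `α` on `[0;t]`; for `t = τ - 1` it is the set of initial cover elements. -/
def P (C : InvariantCover sys Q) {τ : ℕ} (S : Set (Fin τ → C.cover))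
    (α : Fin τ → C.cover) (t : Fin τ) : Set C.cover :=
  if h : (t : ℕ) + 1 < τ then
    {A | ∃ β ∈ S, (∀ s : Fin τ, s ≤ t → β s = α s) ∧ β ⟨t + 1, h⟩ = A}
  else C.initial S

/-- `S` is `(τ, Q)`-spanning in `(𝒜, G)`. -/
def IsSpanning (C : InvariantCover sys Q) {τ : ℕ} (S : Set (Fin τ → C.cover)) : Prop :=
  (Q ⊆ ⋃ A ∈ C.initial S, (A : Set X)) ∧
  ∀ α ∈ S, ∀ t : Fin τ, (t : ℕ) + 1 < τ →
    (⋃ x ∈ (α t : Set X), sys.F x (C.G (α t))) ⊆ ⋃ A ∈ C.P S α t, (A : Set X)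

/-- The expansion number `N (S) = max_{α ∈ S} ∏_{t < τ} #P (α|[0;t])`. -/
def expansionNumber (C : InvariantCover sys Q) {τ : ℕ} (S : Set (Fin τ → C.cover)) : ℕ∞ :=
  ⨆ α ∈ S, ∏ t : Fin τ, (C.P S α t).encard

/-- `r_inv (τ, Q)`: the least expansion number of a `(τ, Q)`-spanning set. -/
def rInv (C : InvariantCover sys Q) (τ : ℕ) : ℕ∞ :=
  ⨅ (S : Set (Fin τ → C.cover)) (_ : C.IsSpanning S), C.expansionNumber S

/-- The entropy `h (𝒜, G) = lim_{τ → ∞} (1/τ) log₂ r_inv (τ, Q)`. The limit exists because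
`τ ↦ log₂ r_inv (τ, Q)` is subadditive on `τ ≥ 1`; it is written as a lower limit, which is
always defined and is equal to the limit. -/
def entropy (C : InvariantCover sys Q) : EReal :=
  liminf (fun τ : ℕ => log2 (C.rInv τ : ℝ≥0∞) / (τ : EReal)) atTop

end InvariantCover

/-- The invariance feedback entropy `h_inv`: the infimum of `h (𝒜, G)` over all invariant covers
(`∞` if there is none). -/
def hInv {X U : Type*} (sys : ControlSystem X U) (Q : Set X) : EReal :=
  ⨅ C : InvariantCover sys Q, C.entropy

/-- The uncertain linear system `F (x, u) = A x + B u + W` with state alphabet `ℝⁿ` and input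
alphabet `U ⊆ ℝᵐ`. -/
def uncertainLinear {n m : ℕ} (A : Matrix (Fin n) (Fin n) ℝ) (B : Matrix (Fin n) (Fin m) ℝ)
    (U : Set (Fin m → ℝ)) (hU : U.Nonempty) (W : Set (Fin n → ℝ)) (hW : W.Nonempty) :
    ControlSystem (Fin n → ℝ) U where
  nonempty_state := inferInstance
  nonempty_input := hU.to_subtype
  F x u := (fun w => A *ᵥ x + B *ᵥ (u : Fin m → ℝ) + w) '' W
  strict _ _ := hW.image _

end FeedbackEntropy

end

/-! Write `q`, `w`, `r` for the `n`-th roots of the volumes of `Q`, `W`, `R`. If `A K + b + W ⊆ R ⊆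
Q` with `K`, `R` compact, Brunn-Minkowski gives `x + w ≤ r`, where `x ^ n = |det A| μ(K)`. Since `r
≤ q`, this yields `x q ≤ r (q - w)`, that is, `c μ(K) ≤ μ(R)` with `c` the growth factor
(`growth_mul_volume_le`).

Cover elements may be nonmeasurable, so volumes are taken of their closures. At each time the
closures of the successors of `α t` have a union of volume at least `c` times that of the closure of
`α t`. Always passing to the largest successor gives a sequence in `S` that loses at most a factor
`#P_t` per step. At the last step the image lies in `Q`, so the volumes cancel and leave `c ^ τ ≤
N(S)` (`pow_le_expansionNumber`).

Brunn-Minkowski is proved by induction on the dimension, slicing along the first coordinate. -/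

open scoped Pointwise

namespace FeedbackEntropy

/-! ### Brunn-Minkowski on the line -/

/-- The slice of `A ⊆ ℝⁿ⁺¹` over the first coordinate `x`. -/
def slice {n : ℕ} (A : Set (Fin (n + 1) → ℝ)) (x : ℝ) : Set (Fin n → ℝ) :=
  {y | (Fin.cons x y : Fin (n + 1) → ℝ) ∈ A}

/-- The translates of `K` by `min L` and of `L` by `max K` both lie in `K + L` and meet in at most
one point. -/
theorem volume_add_le_of_isCompact {K L R : Set ℝ} (hK : IsCompact K) (hL : IsCompact L)
    (hK0 : K.Nonempty) (hL0 : L.Nonempty) (h : K + L ⊆ R) :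
    volume K + volume L ≤ volume R := by
  obtain ⟨k, hk, hkmax⟩ := hK.exists_isGreatest hK0
  obtain ⟨l, hl, hlmin⟩ := hL.exists_isLeast hL0
  have h1 : volume ((fun x => x + l) '' K ∪ (fun x => k + x) '' L) ≤ volume R := by
    apply measure_mono
    rintro _ (⟨x, hx, rfl⟩ | ⟨x, hx, rfl⟩)
    · exact h (add_mem_add hx hl)
    · exact h (add_mem_add hk hx)
  have h2 : AEDisjoint volume ((fun x => x + l) '' K) ((fun x => k + x) '' L) := by
    refine measure_mono_null (t := {k + l}) ?_ (by simp)
    rintro _ ⟨⟨x, hx, rfl⟩, ⟨y, hy, hxy⟩⟩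
    have := hkmax hx
    have := hlmin hy
    simp only [mem_singleton_iff] at *
    linarith
  rw [measure_union₀ (hL.image (by fun_prop)).measurableSet.nullMeasurableSet h2] at h1
  simpa using h1

theorem volume_add_le {S T R : Set ℝ} (hS : MeasurableSet S) (hT : MeasurableSet T)
    (hS0 : S.Nonempty) (hT0 : T.Nonempty) (h : S + T ⊆ R) :
    volume S + volume T ≤ volume R := by
  obtain ⟨s, hs⟩ := hS0
  obtain ⟨t, ht⟩ := hT0
  rw [hS.measure_eq_iSup_isCompact, hT.measure_eq_iSup_isCompact]
  simp only [iSup_and']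
  refine ENNReal.biSup_add_biSup_le' (p := fun K => K ⊆ S ∧ IsCompact K)
    (q := fun K => K ⊆ T ∧ IsCompact K) ⟨∅, empty_subset _, isCompact_empty⟩
    ⟨∅, empty_subset _, isCompact_empty⟩ ?_
  rintro K ⟨hKS, hK⟩ L ⟨hLT, hL⟩
  -- The compact approximants may be empty; adjoining `s` and `t` makes them nonempty.
  calc volume K + volume L ≤ volume (insert s K) + volume (insert t L) := by
        gcongr <;> exact subset_insert _ _
    _ ≤ volume R := volume_add_le_of_isCompact (hK.insert s) (hL.insert t) (insert_nonempty _ _)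
        (insert_nonempty _ _)
        ((add_subset_add (insert_subset hs hKS) (insert_subset ht hLT)).trans h)

/-- A one-dimensional functional inequality of Brunn-Minkowski type. -/
theorem lintegral_add_le_of_superlevel {f g h : ℝ → ℝ} (hf : Measurable f) (hg : Measurable g)
    (hh : Measurable h) (hf0 : 0 ≤ f) (hg0 : 0 ≤ g) (hh0 : 0 ≤ h) (hf1 : f ≤ 1) (hg1 : g ≤ 1)
    (hfs : ∀ r < 1, ∃ x, r < f x) (hgs : ∀ r < 1, ∃ x, r < g x)
    (H : ∀ r, 0 < r → r < 1 → ∀ x y, r < f x → r < g y → r ≤ h (x + y)) :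
    (∫⁻ x, ENNReal.ofReal (f x)) + ∫⁻ x, ENNReal.ofReal (g x) ≤ ∫⁻ x, ENNReal.ofReal (h x) := by
  -- Layer cake: the superlevel sets are compared for each `r`. Below `1` those of `f` and `g` are
  -- nonempty, as the inequality on the line requires; from `1` on they are empty.
  rw [lintegral_eq_lintegral_meas_lt _ (Eventually.of_forall hf0) hf.aemeasurable,
    lintegral_eq_lintegral_meas_lt _ (Eventually.of_forall hg0) hg.aemeasurable,
    lintegral_eq_lintegral_meas_le _ (Eventually.of_forall hh0) hh.aemeasurable,
    ← lintegral_add_left']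
  · refine setLIntegral_mono' measurableSet_Ioi fun r hr => ?_
    rcases lt_or_ge r 1 with hr1 | hr1
    · refine volume_add_le (measurableSet_lt measurable_const hf)
        (measurableSet_lt measurable_const hg) (hfs r hr1) (hgs r hr1) ?_
      rintro _ ⟨x, hx, y, hy, rfl⟩
      exact H r hr hr1 x y hx hy
    · have e1 : {a | r < f a} = ∅ := by
        ext x; simpa using (hf1 x).trans hr1
      have e2 : {a | r < g a} = ∅ := by
        ext x; simpa using (hg1 x).trans hr1
      simp [e1, e2]
  · have : Antitone fun r : ℝ => volume {x | r < f x} :=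
      fun a b hab => measure_mono fun x hx => lt_of_le_of_lt hab hx
    exact this.measurable.aemeasurable

/-! ### Slices and the induction on dimension -/

theorem isCompact_slice {n : ℕ} {A : Set (Fin (n + 1) → ℝ)} (hA : IsCompact A) (x : ℝ) :
    IsCompact (slice A x) := by
  have : slice A x = (fun z : Fin (n + 1) → ℝ => (fun i => z i.succ)) '' (A ∩ {z | z 0 = x}) := by
    ext y
    constructor
    · intro hy
      exact ⟨Fin.cons x y, ⟨hy, by simp⟩, by ext; simp⟩
    · rintro ⟨z, ⟨hz, rfl⟩, rfl⟩
      have : (Fin.cons (z 0) fun i => z i.succ : Fin (n + 1) → ℝ) = z := Fin.cons_self_tail z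
      simpa [slice, this] using hz
  rw [this]
  exact (hA.inter_right (isClosed_eq (by fun_prop) (by fun_prop))).image (by fun_prop)

theorem slice_add {n : ℕ} (A B : Set (Fin (n + 1) → ℝ)) (x y : ℝ) :
    slice A x + slice B y ⊆ slice (A + B) (x + y) := by
  rintro _ ⟨z, hz, w, hw, rfl⟩
  refine ⟨_, hz, _, hw, ?_⟩
  ext i
  refine Fin.cases ?_ (fun i => ?_) i <;> simp

theorem volume_real_slice_le {n : ℕ} {A : Set (Fin (n + 1) → ℝ)} (hA : IsCompact A) (x : ℝ) :
    volume.real (slice A x) ≤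
      volume.real ((fun z : Fin (n + 1) → ℝ => (fun i => z i.succ)) '' A : Set (Fin n → ℝ)) := by
  refine measureReal_mono ?_ (hA.image (by fun_prop)).measure_lt_top.ne
  intro y hy
  exact ⟨_, hy, by ext; simp⟩

theorem slice_eq_preimage {n : ℕ} (A : Set (Fin (n + 1) → ℝ)) (x : ℝ) :
    slice A x = Prod.mk x ⁻¹'
      ((MeasurableEquiv.piFinSuccAbove (fun _ : Fin (n + 1) => ℝ) 0).symm ⁻¹' A) := by
  ext y
  simp [slice, MeasurableEquiv.piFinSuccAbove, Fin.insertNthEquiv]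

theorem measurable_volume_slice {n : ℕ} {A : Set (Fin (n + 1) → ℝ)} (hA : MeasurableSet A) :
    Measurable fun x => volume (slice A x) := by
  have := (MeasurableEquiv.piFinSuccAbove (fun _ : Fin (n + 1) => ℝ) 0).symm.measurable hA
  have h2 := measurable_measure_prodMk_left (ν := (volume : Measure (Fin n → ℝ))) this
  simpa only [slice_eq_preimage] using h2

theorem lintegral_volume_slice {n : ℕ} {A : Set (Fin (n + 1) → ℝ)} (hA : MeasurableSet A) :
    ∫⁻ x, volume (slice A x) = volume A := by
  have h1 := (MeasureTheory.volume_preserving_piFinSuccAbove (fun _ : Fin (n + 1) => ℝ) 0).symm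
  have hm := (MeasurableEquiv.piFinSuccAbove (fun _ : Fin (n + 1) => ℝ) 0).symm.measurable hA
  rw [← h1.measure_preimage hA.nullMeasurableSet, Measure.volume_eq_prod, Measure.prod_apply hm]
  simp only [slice_eq_preimage]

theorem lintegral_volume_real_slice_div {n : ℕ} {A : Set (Fin (n + 1) → ℝ)} (hA : IsCompact A)
    {c : ℝ} (hc : 0 < c) :
    ∫⁻ x, ENNReal.ofReal (volume.real (slice A x) / c) = ENNReal.ofReal (volume.real A / c) := by
  simp_rw [ENNReal.ofReal_div_of_pos hc, div_eq_mul_inv]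
  rw [lintegral_mul_const' _ _ (by simp [hc]),
    ofReal_measureReal hA.measure_lt_top.ne, ← lintegral_volume_slice hA.measurableSet]
  congr 2
  ext x
  rw [ofReal_measureReal (isCompact_slice hA x).measure_lt_top.ne]

/-- Convexity of `t ^ (m + 1)` at `u / a` and `v / b` with weights proportional to `a` and `b`. -/
theorem radon_pow {a b u v : ℝ} (ha : 0 < a) (hb : 0 < b) (hu : 0 ≤ u) (hv : 0 ≤ v) (m : ℕ) :
    (u + v) ^ (m + 1) / (a + b) ^ m ≤ u ^ (m + 1) / a ^ m + v ^ (m + 1) / b ^ m := by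
  have hab : 0 < a + b := by positivity
  have h := (convexOn_pow (𝕜 := ℝ) (m + 1)).2 (mem_Ici.2 (by positivity : 0 ≤ u / a))
    (mem_Ici.2 (by positivity : 0 ≤ v / b)) (by positivity : 0 ≤ a / (a + b))
    (by positivity : 0 ≤ b / (a + b)) (by field_simp)
  simp only [smul_eq_mul] at h
  have e1 : a / (a + b) * (u / a) + b / (a + b) * (v / b) = (u + v) / (a + b) := by field_simp
  rw [e1] at h
  have h2 := mul_le_mul_of_nonneg_left h hab.le
  have e2 : (a + b) * ((u + v) / (a + b)) ^ (m + 1) = (u + v) ^ (m + 1) / (a + b) ^ m := by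
    rw [div_pow, pow_succ (a + b)]; field_simp
  have e3 : (a + b) * (a / (a + b) * (u / a) ^ (m + 1) + b / (a + b) * (v / b) ^ (m + 1))
      = u ^ (m + 1) / a ^ m + v ^ (m + 1) / b ^ m := by
    rw [div_pow, div_pow, pow_succ a, pow_succ b]; field_simp
  rwa [e2, e3] at h2

theorem volume_real_fin_zero {s : Set (Fin 0 → ℝ)} (hs : s.Nonempty) : volume.real s = 1 := by
  rw [Subsingleton.eq_univ_of_nonempty hs]
  simp [measureReal_def, volume_pi]

/-- The largest slice volume is an `m`-th power of a positive number. -/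
theorem exists_pow_eq_iSup_slice {m : ℕ} {A : Set (Fin (m + 1) → ℝ)} (hA : IsCompact A)
    (hpos : 0 < volume.real A) :
    ∃ a : ℝ, 0 < a ∧ (∀ x, volume.real (slice A x) ≤ a ^ m) ∧
      ∀ r < 1, ∃ x, a ^ m * r < volume.real (slice A x) := by
  have hbdd : BddAbove (range fun x => volume.real (slice A x)) :=
    ⟨_, by rintro _ ⟨x, rfl⟩; exact volume_real_slice_le hA x⟩
  obtain ⟨x₀, hx₀⟩ : ∃ x, 0 < volume.real (slice A x) := by
    by_contra! hcon
    have h := lintegral_volume_real_slice_div hA one_pos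
    simp only [fun x => le_antisymm (hcon x) measureReal_nonneg] at h
    simp at h
    linarith
  set M := ⨆ x, volume.real (slice A x) with hM
  have hM0 : 0 < M := hx₀.trans_le (le_ciSup hbdd x₀)
  obtain ⟨a, ha, haM⟩ : ∃ a : ℝ, 0 < a ∧ a ^ m = M := by
    -- For `m = 0` the supremum must equal `a ^ 0 = 1`; it does, because slices are then subsets of
    -- a point, of volume `0` or `1`.
    rcases Nat.eq_zero_or_pos m with rfl | hm
    · refine ⟨1, one_pos, ?_⟩
      have hne : ∀ x, 0 < volume.real (slice A x) → volume.real (slice A x) = 1 := by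
        intro x hx
        apply volume_real_fin_zero
        by_contra hcon
        simp [not_nonempty_iff_eq_empty.1 hcon] at hx
      apply le_antisymm
      · rw [pow_zero, ← hne x₀ hx₀]
        exact le_ciSup hbdd x₀
      · refine ciSup_le fun x => ?_
        rcases (measureReal_nonneg (μ := volume) (s := slice A x)).eq_or_lt with h | h
        · rw [← h]; simp
        · rw [hne x h]; simp
    · exact ⟨M ^ ((m : ℝ)⁻¹), by positivity, Real.rpow_inv_natCast_pow hM0.le hm.ne'⟩
  refine ⟨a, ha, fun x => haM ▸ le_ciSup hbdd x, fun r hr => ?_⟩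
  rw [haM]
  exact exists_lt_of_lt_ciSup (by rw [← hM]; nlinarith)

/-- The Brunn-Minkowski inequality for nonempty compact subsets of `ℝⁿ`. -/
theorem brunn_minkowski (n : ℕ) {A B : Set (Fin n → ℝ)} (hA : IsCompact A) (hB : IsCompact B)
    (hA0 : A.Nonempty) (hB0 : B.Nonempty) {u v : ℝ} (hu : 0 ≤ u) (hv : 0 ≤ v)
    (huA : u ^ n ≤ volume.real A) (hvB : v ^ n ≤ volume.real B) :
    (u + v) ^ n ≤ volume.real (A + B) := by
  induction n generalizing u v with
  | zero => rw [volume_real_fin_zero (hA0.add hB0)]; simp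
  | succ m ih =>
    have hAB : IsCompact (A + B) := hA.add hB
    rcases (measureReal_nonneg (μ := volume) (s := A)).eq_or_lt with hA1 | hA1
    · obtain ⟨a, ha⟩ := hA0
      have hu0 : u = 0 := by
        rw [← hA1] at huA
        exact pow_eq_zero_iff (n := m + 1) (by simp) |>.1 (le_antisymm huA (by positivity))
      -- When `A` is null it suffices that `A + B` contains a translate of `B`.
      rw [hu0, zero_add]
      refine hvB.trans ?_
      rw [measureReal_def, ← measure_preimage_add volume (-a) B]
      refine measureReal_mono ?_ hAB.measure_lt_top.ne
      intro x hx
      exact ⟨a, ha, _, hx, by simp⟩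
    rcases (measureReal_nonneg (μ := volume) (s := B)).eq_or_lt with hB1 | hB1
    · obtain ⟨b, hb⟩ := hB0
      have hv0 : v = 0 := by
        rw [← hB1] at hvB
        exact pow_eq_zero_iff (n := m + 1) (by simp) |>.1 (le_antisymm hvB (by positivity))
      rw [hv0, add_zero]
      refine huA.trans ?_
      rw [measureReal_def, ← measure_preimage_add volume (-b) A]
      refine measureReal_mono ?_ hAB.measure_lt_top.ne
      intro x hx
      exact ⟨_, hx, b, hb, by simp⟩
    obtain ⟨a, ha, hale, halt⟩ := exists_pow_eq_iSup_slice hA hA1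
    obtain ⟨b, hb, hble, hblt⟩ := exists_pow_eq_iSup_slice hB hB1
    have ham : 0 < a ^ m := by positivity
    have hbm : 0 < b ^ m := by positivity
    have habm : 0 < (a + b) ^ m := by positivity
    have hmeas : ∀ {C : Set (Fin (m + 1) → ℝ)} (c : ℝ), IsCompact C →
        Measurable fun x => volume.real (slice C x) / c := fun c hC =>
      (measurable_volume_slice hC.measurableSet).ennreal_toReal.div_const c
    -- Dividing the slice volumes of `A` and `B` by their suprema `a ^ m` and `b ^ m` gives both
    -- functions supremum `1`.
    have key := lintegral_add_le_of_superlevel (hmeas (a ^ m) hA) (hmeas (b ^ m) hB)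
      (hmeas ((a + b) ^ m) hAB) (fun x => by simp; positivity) (fun x => by simp; positivity)
      (fun x => by simp; positivity) (fun x => (div_le_one ham).2 (hale x))
      (fun x => (div_le_one hbm).2 (hble x))
      (fun r hr => (halt r hr).imp fun x hx => (lt_div_iff₀' ham).2 hx)
      (fun r hr => (hblt r hr).imp fun x hx => (lt_div_iff₀' hbm).2 hx) ?_
    · rw [lintegral_volume_real_slice_div hA ham, lintegral_volume_real_slice_div hB hbm,
        lintegral_volume_real_slice_div hAB habm, ← ENNReal.ofReal_add (by positivity)
        (by positivity), ENNReal.ofReal_le_ofReal_iff (by positivity)] at key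
      have h1 : u ^ (m + 1) / a ^ m + v ^ (m + 1) / b ^ m ≤ volume.real (A + B) / (a + b) ^ m :=
        le_trans (by gcongr) key
      exact (div_le_div_iff_of_pos_right habm).1 ((radon_pow ha hb hu hv m).trans h1)
    · intro r hr0 hr1 x y hx hy
      rw [lt_div_iff₀' ham] at hx
      rw [lt_div_iff₀' hbm] at hy
      rw [le_div_iff₀' habm]
      have hne : ∀ {C : Set (Fin m → ℝ)}, 0 < volume.real C → C.Nonempty := by
        intro C hC
        by_contra hcon
        simp [not_nonempty_iff_eq_empty.1 hcon] at hC
      -- `ρ` is the `m`-th root of `r`. For `m = 0` any `ρ ≥ 0` serves, since `ρ ^ 0 = 1 > r`.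
      obtain ⟨ρ, hρ, hρr, hρ'⟩ : ∃ ρ : ℝ, 0 ≤ ρ ∧ r ≤ ρ ^ m ∧ (m = 0 ∨ ρ ^ m = r) := by
        rcases Nat.eq_zero_or_pos m with rfl | hm
        · exact ⟨0, le_rfl, by simpa using hr1.le, Or.inl rfl⟩
        · have := Real.rpow_inv_natCast_pow hr0.le hm.ne'
          exact ⟨r ^ ((m : ℝ)⁻¹), by positivity, this.ge, Or.inr this⟩
      have hxn := hne ((by positivity : 0 < a ^ m * r).trans hx)
      have hyn := hne ((by positivity : 0 < b ^ m * r).trans hy)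
      have h := ih (isCompact_slice hA x) (isCompact_slice hB y) hxn hyn
        (u := a * ρ) (v := b * ρ) (by positivity) (by positivity)
        (by
          rcases hρ' with rfl | h
          · simp [volume_real_fin_zero hxn]
          · rw [mul_pow, h]; exact hx.le)
        (by
          rcases hρ' with rfl | h
          · simp [volume_real_fin_zero hyn]
          · rw [mul_pow, h]; exact hy.le)
      calc (a + b) ^ m * r ≤ (a + b) ^ m * ρ ^ m := by gcongr
        _ = (a * ρ + b * ρ) ^ m := by rw [← mul_pow, add_mul]
        _ ≤ _ := h
        _ ≤ _ := measureReal_mono (slice_add A B x y)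
          (isCompact_slice hAB _).measure_lt_top.ne

/-! ### Volume growth under the affine dynamics -/

/-- The growth factor `|det A| μ(Q) / (μ(Q)^{1/n} - μ(W)^{1/n})ⁿ`. -/
noncomputable def growth {n : ℕ} (A : Matrix (Fin n) (Fin n) ℝ) (Q W : Set (Fin n → ℝ)) : ℝ≥0∞ :=
  ENNReal.ofReal |A.det| *
    (volume Q / (volume Q ^ (1 / (n : ℝ)) - volume W ^ (1 / (n : ℝ))) ^ n)

theorem volume_real_image_mulVec {n : ℕ} (A : Matrix (Fin n) (Fin n) ℝ) (K : Set (Fin n → ℝ)) :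
    volume.real ((fun x => A *ᵥ x) '' K) = |A.det| * volume.real K := by
  have h := Measure.addHaar_image_linearMap volume (Matrix.toLin' A) K
  rw [LinearMap.det_toLin'] at h
  rw [measureReal_def, measureReal_def, ← ENNReal.toReal_ofReal (abs_nonneg A.det),
    ← ENNReal.toReal_mul, ← h]
  rfl

theorem pow_add_le_of_affine_image {n : ℕ} (A : Matrix (Fin n) (Fin n) ℝ) (b : Fin n → ℝ)
    {K V R : Set (Fin n → ℝ)} (hK : IsCompact K) (hV : IsCompact V) (hR : IsCompact R)
    (hK0 : K.Nonempty) (hV0 : V.Nonempty) (h : ∀ x ∈ K, ∀ w ∈ V, A *ᵥ x + b + w ∈ R)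
    {u v : ℝ} (hu : 0 ≤ u) (hv : 0 ≤ v) (huK : u ^ n ≤ |A.det| * volume.real K)
    (hvV : v ^ n ≤ volume.real V) : (u + v) ^ n ≤ volume.real R := by
  have hAK : IsCompact ((fun x => A *ᵥ x) '' K) := hK.image (by fun_prop)
  refine (brunn_minkowski n hAK hV (hK0.image _) hV0 hu hv
    (by rwa [volume_real_image_mulVec]) hvV).trans ?_
  rw [measureReal_def, ← measure_preimage_add volume (-b)]
  refine measureReal_mono ?_ hR.measure_lt_top.ne
  rintro x ⟨_, ⟨y, hy, rfl⟩, w, hw, hx⟩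
  have e : x = A *ᵥ y + b + w := by
    simp only at hx
    rw [add_right_comm, hx]; abel
  exact e ▸ h y hy w hw

/-- Brunn-Minkowski is available for compact sets only, so `W` is exhausted from inside by compact
sets. -/
theorem add_le_of_affine_image {n : ℕ} (hn : n ≠ 0) (A : Matrix (Fin n) (Fin n) ℝ)
    (b : Fin n → ℝ) {K W R : Set (Fin n → ℝ)} (hK : IsCompact K) (hR : IsCompact R)
    (hWm : NullMeasurableSet W volume) (hK0 : K.Nonempty) (hW0 : W.Nonempty)
    (hWtop : volume W ≠ ∞) (h : ∀ x ∈ K, ∀ w ∈ W, A *ᵥ x + b + w ∈ R)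
    {u v r : ℝ} (hu : 0 ≤ u) (hr : 0 ≤ r)
    (huK : u ^ n ≤ |A.det| * volume.real K)
    (hvW : v ^ n = volume.real W) (hrR : r ^ n = volume.real R) : u + v ≤ r := by
  have main : ∀ V ⊆ W, IsCompact V → V.Nonempty → ∀ v', 0 ≤ v' → v' ^ n ≤ volume.real V →
      u + v' ≤ r := by
    intro V hVW hV hV0 v' hv' hle
    refine le_of_pow_le_pow_left₀ hn hr (hrR ▸ ?_)
    exact pow_add_le_of_affine_image A b hK hV hR hK0 hV0 (fun x hx w hw => h x hx w (hVW hw))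
      hu hv' huK hle
  obtain ⟨w₀, hw₀⟩ := hW0
  -- A single point of `W` already gives `u ≤ r`, which settles negative `v'`.
  have h0 : u + 0 ≤ r := main {w₀} (by simpa using hw₀) isCompact_singleton (by simp) 0 le_rfl
    (by simp [hn])
  suffices ∀ v' < v, v' ≤ r - u by linarith [le_of_forall_lt_imp_le_of_dense this]
  intro v' hlt
  rcases lt_or_ge v' 0 with hneg | hv'
  · linarith
  have hlt' : ENNReal.ofReal (v' ^ n) < volume W := by
    rw [← ofReal_measureReal hWtop, ← hvW]
    exact (ENNReal.ofReal_lt_ofReal_iff (pow_pos (hv'.trans_lt hlt) n)).2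
      (pow_lt_pow_left₀ hlt hv' hn)
  obtain ⟨W', hW'W, hW'm, hW'e⟩ := hWm.exists_measurable_subset_ae_eq
  rw [← measure_congr hW'e] at hlt'
  obtain ⟨V, hVW, hV, hVlt⟩ := hW'm.exists_lt_isCompact hlt'
  have hVle : v' ^ n ≤ volume.real V :=
    (ENNReal.ofReal_le_iff_le_toReal hV.measure_lt_top.ne).1 hVlt.le
  have hVne : V.Nonempty := by
    by_contra hcon
    simp [not_nonempty_iff_eq_empty.1 hcon] at hVlt
  linarith [main V (hVW.trans hW'W) hV hVne v' hv' hVle]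

theorem exists_pow_eq_volume {n : ℕ} (hn : n ≠ 0) {S : Set (Fin n → ℝ)} (hS : volume S ≠ ∞) :
    ∃ s : ℝ, 0 ≤ s ∧ s ^ n = volume.real S ∧ volume S = ENNReal.ofReal (s ^ n) ∧
      volume S ^ (1 / (n : ℝ)) = ENNReal.ofReal s := by
  have h1 := Real.rpow_inv_natCast_pow (measureReal_nonneg (μ := volume) (s := S)) hn
  refine ⟨volume.real S ^ ((n : ℝ)⁻¹), by positivity, h1, ?_, ?_⟩
  · rw [h1, ofReal_measureReal hS]
  · rw [← ENNReal.ofReal_rpow_of_nonneg measureReal_nonneg (by positivity),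
      ofReal_measureReal hS, one_div]

/-- A set that contains an affine image of `K` perturbed by `W` is larger than `K` by the growth
factor. -/
theorem growth_mul_volume_le {n : ℕ} (hn : n ≠ 0) (A : Matrix (Fin n) (Fin n) ℝ)
    (b : Fin n → ℝ) {K W R Q : Set (Fin n → ℝ)} (hK : IsCompact K) (hR : IsCompact R)
    (hQ : IsCompact Q) (hRQ : R ⊆ Q) (hWm : NullMeasurableSet W volume) (hW0 : W.Nonempty)
    (hWQ : W ⊆ Q) (h : ∀ x ∈ K, ∀ w ∈ W, A *ᵥ x + b + w ∈ R) :
    growth A Q W * volume K ≤ volume R := by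
  rcases K.eq_empty_or_nonempty with rfl | hK0
  · simp
  have hQt := hQ.measure_lt_top (μ := volume).ne
  have hWt : volume W ≠ ∞ := ne_top_of_le_ne_top hQt (measure_mono hWQ)
  obtain ⟨q, hq0, hq, hqv, hqr⟩ := exists_pow_eq_volume hn hQt
  obtain ⟨w, hw0, hw, hwv, hwr⟩ := exists_pow_eq_volume hn hWt
  obtain ⟨r, hr0, hr, hrv, hrr⟩ := exists_pow_eq_volume hn hR.measure_lt_top.ne
  have hx1 := Real.rpow_inv_natCast_pow
    (mul_nonneg (abs_nonneg A.det) (measureReal_nonneg (μ := volume) (s := K))) hn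
  set x := (|A.det| * volume.real K) ^ ((n : ℝ)⁻¹) with hx
  have hx0 : 0 ≤ x := by positivity
  have hxw : x + w ≤ r := add_le_of_affine_image hn A b hK hR hWm hK0 hW0 hWt h hx0 hr0 hx1.le hw hr
  have hrq : r ≤ q := le_of_pow_le_pow_left₀ hn hq0 (by
    rw [hq, hr]; exact measureReal_mono hRQ hQt)
  have hdK : ENNReal.ofReal |A.det| * volume K = ENNReal.ofReal (x ^ n) := by
    rw [hx1, ENNReal.ofReal_mul (abs_nonneg _), ofReal_measureReal hK.measure_lt_top.ne]
  rw [growth, mul_right_comm, hdK, hqr, hwr, hrv, hqv]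
  rcases (by linarith : w ≤ q).eq_or_lt with hwq | hwq
  -- The growth factor may be infinite here, but then `x = 0` and `0 * ∞ = 0`.
  · have : x = 0 := by linarith
    simp [this, hn]
  · have hpos : 0 < q - w := by linarith
    rw [← ENNReal.ofReal_sub _ hw0, ← ENNReal.ofReal_pow hpos.le,
      ← ENNReal.ofReal_div_of_pos (by positivity), ← ENNReal.ofReal_mul (by positivity)]
    apply ENNReal.ofReal_le_ofReal
    rw [← div_pow, ← mul_pow]
    refine pow_le_pow_left₀ (by positivity) ?_ n
    rw [← mul_div_assoc, div_le_iff₀ hpos]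
    nlinarith

/-! ### Counting along a spanning set -/

namespace InvariantCover

variable {X U : Type*} {sys : ControlSystem X U} {Q : Set X}

theorem P_congr (C : InvariantCover sys Q) {τ : ℕ} (S : Set (Fin τ → C.cover))
    {α β : Fin τ → C.cover} {t : Fin τ} (h : ∀ s ≤ t, α s = β s) : C.P S α t = C.P S β t := by
  unfold P
  split_ifs with ht
  · ext A
    refine exists_congr fun γ => and_congr_right fun _ => and_congr_left fun _ =>
      forall₂_congr fun s hs => ?_
    rw [h s hs]
  · rfl

/-- Pigeonhole: subadditivity bounds the union by the number of members times the largest measure.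
-/
theorem exists_measure_biUnion_closure_le [TopologicalSpace X] [MeasurableSpace X] (μ : Measure X)
    (C : InvariantCover sys Q) {T : Set C.cover} (hT : T.Nonempty) :
    ∃ A ∈ T, μ (⋃ B ∈ T, closure (B : Set X)) ≤
      ((T.encard : ℕ∞) : ℝ≥0∞) * μ (closure (A : Set X)) := by
  have := C.finite.to_subtype
  have hfin : T.Finite := T.toFinite
  obtain ⟨A, hA, hmax⟩ := exists_max_image T (fun B => μ (closure (B : Set X))) hfin hT
  refine ⟨A, hA, ?_⟩
  have h1 := measure_biUnion_finset_le (μ := μ) hfin.toFinset fun B => closure (B : Set X)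
  simp only [Finite.mem_toFinset] at h1
  refine h1.trans ((Finset.sum_le_card_nsmul _ _ (μ (closure (A : Set X))) fun B hB =>
    hmax B (hfin.mem_toFinset.1 hB)).trans ?_)
  rw [hfin.encard_eq_coe_toFinset_card, nsmul_eq_mul]
  simp

/-- If the closures of the cover elements grow in measure by the factor `c` under the dynamics, then
the expansion number of a spanning set of sequences of length `τ` is at least `c ^ τ`. -/
theorem pow_le_expansionNumber [TopologicalSpace X] [MeasurableSpace X] (μ : Measure X)
    (C : InvariantCover sys Q) {c : ℝ≥0∞} (hQ0 : μ Q ≠ 0) (hQt : μ Q ≠ ∞)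
    (hstep : ∀ (A : C.cover) (T : Set C.cover),
      (⋃ x ∈ (A : Set X), sys.F x (C.G A)) ⊆ ⋃ B ∈ T, (B : Set X) →
      c * μ (closure (A : Set X)) ≤ μ (⋃ B ∈ T, closure (B : Set X)))
    (hlast : ∀ A : C.cover, c * μ (closure (A : Set X)) ≤ μ Q)
    {N : ℕ} {S : Set (Fin (N + 1) → C.cover)} (hS : C.IsSpanning S) :
    c ^ (N + 1) ≤ ((C.expansionNumber S : ℕ∞) : ℝ≥0∞) := by
  let p : (Fin (N + 1) → C.cover) → ℕ → ℝ≥0∞ := fun α t =>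
    if h : t < N + 1 then (((C.P S α ⟨t, h⟩).encard : ℕ∞) : ℝ≥0∞) else 1
  have hinit : (C.initial S).Nonempty := by
    by_contra hcon
    rw [not_nonempty_iff_eq_empty] at hcon
    have := hS.1
    rw [hcon] at this
    simp only [mem_empty_iff_false, iUnion_of_empty, iUnion_empty, subset_empty_iff] at this
    exact hQ0 (by rw [this, measure_empty])
  -- Greedy sequence. The product stops before time `k`; the separate factor `#(C.initial S)` pays
  -- for the choice of the first element.
  have path : ∀ k (hk : k < N + 1), ∃ α ∈ S, μ Q * c ^ k ≤
      (((C.initial S).encard : ℕ∞) : ℝ≥0∞) * (∏ t ∈ Finset.range k, p α t) *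
        μ (closure (α ⟨k, hk⟩ : Set X)) := by
    intro k
    induction k with
    | zero =>
      intro hk
      obtain ⟨A, ⟨β, hβ, _, rfl⟩, hle⟩ := C.exists_measure_biUnion_closure_le μ hinit
      refine ⟨β, hβ, ?_⟩
      simp only [pow_zero, mul_one, Finset.range_zero, Finset.prod_empty]
      exact (measure_mono (hS.1.trans (iUnion₂_mono fun _ _ => subset_closure))).trans hle
    | succ k ih =>
      intro hk
      have hk' : k < N + 1 := by omega
      obtain ⟨α, hα, hle⟩ := ih hk'
      have hne : (C.P S α ⟨k, hk'⟩).Nonempty := by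
        refine ⟨α ⟨k + 1, hk⟩, ?_⟩
        rw [P, dif_pos hk]
        exact ⟨α, hα, fun _ _ => rfl, rfl⟩
      obtain ⟨A, hA, hAle⟩ := C.exists_measure_biUnion_closure_le μ hne
      have hA' := hA
      rw [P, dif_pos hk] at hA'
      obtain ⟨β, hβ, hβα, rfl⟩ := hA'
      refine ⟨β, hβ, ?_⟩
      -- Switching from `α` to `β` leaves the factors up to time `k` unchanged, as they depend only
      -- on the common past.
      have hp : ∀ t ≤ k, p β t = p α t := by
        intro t ht
        simp only [p]
        split_ifs with h
        · rw [C.P_congr S fun s hs =>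
            hβα s (hs.trans (show (⟨t, h⟩ : Fin (N + 1)) ≤ ⟨k, hk'⟩ from ht))]
        · rfl
      have hprod : ∏ t ∈ Finset.range (k + 1), p β t = ∏ t ∈ Finset.range (k + 1), p α t :=
        Finset.prod_congr rfl fun t ht => hp t (by simpa [Nat.lt_succ_iff] using ht)
      have hgrow := (hstep _ _ (hS.2 α hα ⟨k, hk'⟩ hk)).trans hAle
      have hpk : p α k = (((C.P S α ⟨k, hk'⟩).encard : ℕ∞) : ℝ≥0∞) := dif_pos hk'
      rw [hprod, Finset.prod_range_succ, hpk]
      calc μ Q * c ^ (k + 1) = c * (μ Q * c ^ k) := by ring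
        _ ≤ c * ((((C.initial S).encard : ℕ∞) : ℝ≥0∞) * (∏ t ∈ Finset.range k, p α t) *
            μ (closure (α ⟨k, hk'⟩ : Set X))) := by gcongr
        _ = (((C.initial S).encard : ℕ∞) : ℝ≥0∞) * (∏ t ∈ Finset.range k, p α t) *
            (c * μ (closure (α ⟨k, hk'⟩ : Set X))) := by ring
        _ ≤ (((C.initial S).encard : ℕ∞) : ℝ≥0∞) * (∏ t ∈ Finset.range k, p α t) *
            ((((C.P S α ⟨k, hk'⟩).encard : ℕ∞) : ℝ≥0∞) *
              μ (closure (β ⟨k + 1, hk⟩ : Set X))) := by gcongr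
        _ = _ := by ring
  obtain ⟨α, hα, hle⟩ := path N (Nat.lt_succ_self N)
  -- The convention for `P` at the final time makes the factor for the initial choice reappear as
  -- the last factor of the expansion number.
  have hpN : p α N = (((C.initial S).encard : ℕ∞) : ℝ≥0∞) := by
    simp [p, P]
  have hprod : ∏ t ∈ Finset.range (N + 1), p α t =
      ((∏ t : Fin (N + 1), (C.P S α t).encard : ℕ∞) : ℝ≥0∞) := by
    rw [Finset.prod_range, ← ENat.toENNRealRingHom_apply, map_prod]
    exact Finset.prod_congr rfl fun t _ => dif_pos t.2
  have hexp : ∏ t ∈ Finset.range (N + 1), p α t ≤ ((C.expansionNumber S : ℕ∞) : ℝ≥0∞) := by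
    rw [hprod, ENat.toENNReal_le]
    exact le_iSup₂ (f := fun α (_ : α ∈ S) => ∏ t, (C.P S α t).encard) α hα
  refine le_trans ?_ hexp
  rw [← ENNReal.mul_le_mul_iff_right hQ0 hQt, Finset.prod_range_succ, hpN]
  calc μ Q * c ^ (N + 1) = c * (μ Q * c ^ N) := by ring
    _ ≤ c * ((((C.initial S).encard : ℕ∞) : ℝ≥0∞) * (∏ t ∈ Finset.range N, p α t) *
        μ (closure (α ⟨N, Nat.lt_succ_self N⟩ : Set X))) := by gcongr
    _ = (((C.initial S).encard : ℕ∞) : ℝ≥0∞) * (∏ t ∈ Finset.range N, p α t) *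
        (c * μ (closure (α ⟨N, Nat.lt_succ_self N⟩ : Set X))) := by ring
    _ ≤ (((C.initial S).encard : ℕ∞) : ℝ≥0∞) * (∏ t ∈ Finset.range N, p α t) * μ Q := by
      gcongr
      exact hlast _
    _ = _ := by ring

theorem le_entropy_of_pow_le (C : InvariantCover sys Q) {c : ℝ≥0∞}
    (h : ∀ (N : ℕ) (S : Set (Fin (N + 1) → C.cover)), C.IsSpanning S →
      c ^ (N + 1) ≤ ((C.expansionNumber S : ℕ∞) : ℝ≥0∞)) : log2 c ≤ C.entropy := by
  refine le_liminf_of_le (by isBoundedDefault) ?_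
  filter_upwards [eventually_ge_atTop 1] with τ hτ
  obtain ⟨N, rfl⟩ := Nat.exists_eq_add_of_le' hτ
  have hr : c ^ (N + 1) ≤ ((C.rInv (N + 1) : ℕ∞) : ℝ≥0∞) := by
    rw [rInv]
    simp only [ENat.toENNReal_iInf]
    exact le_iInf₂ (h N)
  have hpos : (0 : EReal) < ((N + 1 : ℕ) : EReal) := by exact_mod_cast Nat.succ_pos N
  rw [EReal.le_div_iff_mul_le hpos (EReal.natCast_ne_top _)]
  have hlog := ENNReal.log_monotone hr
  rw [ENNReal.log_pow] at hlog
  have h2 : (0 : ℝ) < Real.log 2 := Real.log_pos one_lt_two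
  calc log2 c * ((N + 1 : ℕ) : EReal)
      = ((N + 1 : ℕ) : EReal) * ENNReal.log c / (Real.log 2 : ℝ) := by
        rw [log2, mul_comm, EReal.mul_div]
    _ ≤ _ := EReal.div_le_div_right_of_nonneg (by exact_mod_cast h2.le) hlog

end InvariantCover

/-! ### Application to uncertain linear systems -/

/-- For fixed `w` the transition is continuous and `R` is closed, so an inclusion valid on `D`
passes to the compact set `closure D`. -/
theorem growth_closure_le {n m : ℕ} (hn : n ≠ 0)
    (A : Matrix (Fin n) (Fin n) ℝ) (B : Matrix (Fin n) (Fin m) ℝ)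
    {U : Set (Fin m → ℝ)} (hU : U.Nonempty)
    {W Q D R : Set (Fin n → ℝ)} (hW : W.Nonempty) (hWQ : W ⊆ Q)
    (hWmeas : NullMeasurableSet W volume) (hQ : IsCompact Q) (hD : D ⊆ Q) (hR : IsClosed R)
    (hRQ : R ⊆ Q) (u : U) (h : (⋃ x ∈ D, (uncertainLinear A B U hU W hW).F x u) ⊆ R) :
    growth A Q W * volume (closure D) ≤ volume R := by
  refine growth_mul_volume_le hn A (B *ᵥ (u : Fin m → ℝ)) (hQ.closure_of_subset hD)
    (hQ.of_isClosed_subset hR hRQ) hQ hRQ hWmeas hW hWQ fun x hx w hw => ?_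
  have hc : Continuous fun x : Fin n → ℝ => A *ᵥ x + B *ᵥ (u : Fin m → ℝ) + w := by fun_prop
  have hmaps : MapsTo (fun x : Fin n → ℝ => A *ᵥ x + B *ᵥ (u : Fin m → ℝ) + w) D R :=
    fun y hy => h (mem_biUnion hy ⟨w, hw, rfl⟩)
  exact hR.closure_subset_iff.2 hmaps.image_subset
    (image_closure_subset_closure_image hc ⟨x, hx, rfl⟩)

end FeedbackEntropy

theorem mainTheorem2 {n m : ℕ} (hn : 1 ≤ n)
    (A : Matrix (Fin n) (Fin n) ℝ) (B : Matrix (Fin n) (Fin m) ℝ)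
    (U : Set (Fin m → ℝ)) (hU : U.Nonempty)
    (W Q : Set (Fin n → ℝ)) (hW : W.Nonempty) (hWQ : W ⊆ Q)
    (hWmeas : NullMeasurableSet W volume) (hQ : IsCompact Q) :
    FeedbackEntropy.log2
        (ENNReal.ofReal |A.det| *
          (volume Q /
            (volume Q ^ (1 / (n : ℝ)) - volume W ^ (1 / (n : ℝ))) ^ n)) ≤
      FeedbackEntropy.hInv (FeedbackEntropy.uncertainLinear A B U hU W hW) Q := by
  change FeedbackEntropy.log2 (FeedbackEntropy.growth A Q W) ≤ _
  refine le_iInf fun C => C.le_entropy_of_pow_le fun N S hS => ?_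
  rcases eq_or_ne (volume Q) 0 with hQ0 | hQ0
  -- Here the growth factor is `0`, because `0 / y = 0` for every `y`, including `y = 0`.
  · simp [FeedbackEntropy.growth, hQ0]
  have hn0 : n ≠ 0 := by omega
  refine C.pow_le_expansionNumber volume hQ0 hQ.measure_lt_top.ne (fun D T hT => ?_)
    (fun D => ?_) hS
  -- Finiteness of the cover makes the union of closures closed.
  · have := C.finite.to_subtype
    exact FeedbackEntropy.growth_closure_le hn0 A B hU hW hWQ hWmeas hQ (C.subset D D.2)
      (T.toFinite.isClosed_biUnion fun _ _ => isClosed_closure)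
      (iUnion₂_subset fun E _ => hQ.isClosed.closure_subset_iff.2 (C.subset E E.2)) (C.G D)
      (hT.trans (iUnion₂_mono fun _ _ => subset_closure))
  · exact FeedbackEntropy.growth_closure_le hn0 A B hU hW hWQ hWmeas hQ (C.subset D D.2)
      hQ.isClosed subset_rfl (C.G D) (C.invariant D)
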